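/- Fix an infinite cardinal $\kappa$ and a $\kappa^+$-saturated nonstandard universe $(V(X),V(Y),{*})$, that is: a bounded elementary embedding ${*}$ between the superstructures over base sets $X$ (infinite) and $Y$, with ${*}X=Y$, which is proper (for every infinite $A\subseteq X$ the set $\{{*}a : a\in A\}$ is a proper subset of ${*}A$), such that every family of at most $\kappa$ internal sets with the finite intersection property has a common element. A $\sigma$-set (respectively, a $\pi$-set) is a union (respectively, an intersection) of at most $\kappa$ internal sets. A hyperfinite associative ring is a hyperfinite internal set $R$ with internal operations $+$ and $\times$ that satisfy the axioms of an associative ring (not necessarily commutative or unital). A hyperfinite topological triple over $R$ is a triple $\langle R,R_b,\rho\rangle$, where $R_b\subseteq R$ is a $\sigma$-set closed under $+$ and $\times$, and $\rho$ is an equivalence relation on $R$ that is a $\pi$-set, such that $\alpha\in R_b$ and $\alpha\mathrel{\rho}\beta$ imply $\beta\in R_b$, and the restriction of $\rho$ to $R_b$ is a congruence for $+$ and $\times$. Give $R_b/\rho$ the induced operations and the topology in which the sets $$\{\beta^{\rho} : \beta\in R_b,\ \beta^{\rho}\subseteq F\}\ni\alpha^\rho,\qquad F\subseteq R_b \text{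 internal},$$ form a base of neighbourhoods of the point $\alpha^{\rho}$, where $\beta^\rho$ is the $\rho$-class of $\beta$. A topological field $K$ is called abstractly approximable by finite associative rings if there are a hyperfinite associative ring $R$ and a hyperfinite topological triple $\langle R,R_b,\rho\rangle$ over it such that $K$ is topologically isomorphic to $R_b/\rho$, i.e. there is a homeomorphism between them that preserves $+$ and $\times$. Proposition. No non-discrete locally compact Hausdorff topological field is abstractly approximable by finite associative rings. -/

import Mathlib

universe u v

open scoped Cardinal

/-! ### Superstructures and bounded formulas -/

/-- The levels of the superstructure over `X`:
`V₀(X) = X` and `Vₙ₊₁(X) = Vₙ(X) ∪ 𝒫(Vₙ(X))`. -/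
def superLevel (X : ZFSet.{v}) : ℕ → ZFSet.{v}
  | 0 => X
  | n + 1 => superLevel X n ∪ (superLevel X n).powerset

/-- The superstructure `V(X) = ⋃ₙ Vₙ(X)`. -/
def superstructure (X : ZFSet.{v}) : Set ZFSet.{v} :=
  {x | ∃ n, x ∈ superLevel X n}

/-- `X` is a base set: its elements are non-empty and have no elements in `V(X)`, so that they
behave as atoms (urelements) of the superstructure. -/
def IsBaseSet (X : ZFSet.{v}) : Prop :=
  ∅ ∉ X ∧ ∀ x ∈ X, ∀ y ∈ superstructure X, y ∉ x

/-- Bounded (quantifier) formulas of the language of set theory, with variables `x₀, x₁, …`.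
The formula `bex i j φ` is `∃ xᵢ ∈ xⱼ, φ`. -/
inductive BoundedSetFormula : Type
  | eq (i j : ℕ) : BoundedSetFormula
  | mem (i j : ℕ) : BoundedSetFormula
  | neg (φ : BoundedSetFormula) : BoundedSetFormula
  | and (φ ψ : BoundedSetFormula) : BoundedSetFormula
  | bex (i j : ℕ) (φ : BoundedSetFormula) : BoundedSetFormula

/-- Satisfaction of a bounded formula in the structure `(M, ∈)` under an assignment `v`. -/
def BoundedSetFormula.Sat (M : Set ZFSet.{v}) : BoundedSetFormula → (ℕ → ZFSet.{v}) → Prop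
  | .eq i j, v => v i = v j
  | .mem i j, v => v i ∈ v j
  | .neg φ, v => ¬ φ.Sat M v
  | .and φ ψ, v => φ.Sat M v ∧ ψ.Sat M v
  | .bex i j φ, v => ∃ y ∈ M, y ∈ v j ∧ φ.Sat M (Function.update v i y)

/-! ### Nonstandard universes -/

/-- A nonstandard universe `(V(X), V(Y), *)`: base sets `X` (infinite) and `Y`, and a map
`* : V(X) → V(Y)` with `*X = Y` which satisfies the transfer principle (it is elementary for
bounded formulas) and is proper. Only the values of `star` on `V(X)` matter. -/
structure NonstandardUniverse : Type (v + 1) where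
  X : ZFSet.{v}
  Y : ZFSet.{v}
  isBaseSet_X : IsBaseSet X
  isBaseSet_Y : IsBaseSet Y
  infinite_X : {x | x ∈ X}.Infinite
  star : ZFSet.{v} → ZFSet.{v}
  star_mem : ∀ a ∈ superstructure X, star a ∈ superstructure Y
  star_X : star X = Y
  transfer : ∀ (φ : BoundedSetFormula) (v : ℕ → ZFSet.{v}), (∀ i, v i ∈ superstructure X) →
    (φ.Sat (superstructure X) v ↔ φ.Sat (superstructure Y) (fun i => star (v i)))
  proper : ∀ A ⊆ X, {x | x ∈ A}.Infinite → ∃ y ∈ star A, ∀ a ∈ A, y ≠ star a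

namespace NonstandardUniverse

/-- Internal sets: the non-atoms that are elements of `*A` for some standard set `A`. -/
def IsInternalSet (U : NonstandardUniverse.{v}) (S : ZFSet.{v}) : Prop :=
  S ∉ U.Y ∧ ∃ A ∈ superstructure U.X, A ∉ U.X ∧ S ∈ U.star A

/-- The set of all finite subsets of `A`. -/
noncomputable def finiteSubsets (A : ZFSet.{v}) : ZFSet.{v} :=
  A.powerset.sep (fun s => {x | x ∈ s}.Finite)

/-- Hyperfinite sets: the elements of `*(P_fin(A))` for a standard set `A`. -/
def IsHyperfinite (U : NonstandardUniverse.{v}) (T : ZFSet.{v}) : Prop :=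
  ∃ A ∈ superstructure U.X, A ∉ U.X ∧ T ∈ U.star (finiteSubsets A)

/-- `κ⁺`-saturation: a family of at most `κ` internal sets with the finite intersection property
has a common element. -/
def IsSaturated (U : NonstandardUniverse.{v}) (κ : Cardinal.{v + 1}) : Prop :=
  ∀ 𝓕 : Set ZFSet.{v}, (∀ F ∈ 𝓕, U.IsInternalSet F) → #𝓕 ≤ κ →
    (∀ 𝓖 ⊆ 𝓕, 𝓖.Finite → ∃ x, ∀ F ∈ 𝓖, x ∈ F) → ∃ x, ∀ F ∈ 𝓕, x ∈ F

/-- `σ`-sets: unions of at most `κ` internal sets. -/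
def IsSigmaSet (U : NonstandardUniverse.{v}) (κ : Cardinal.{v + 1}) (S : Set ZFSet.{v}) : Prop :=
  ∃ 𝓕 : Set ZFSet.{v}, (∀ F ∈ 𝓕, U.IsInternalSet F) ∧ #𝓕 ≤ κ ∧ S = {x | ∃ F ∈ 𝓕, x ∈ F}

/-- `π`-sets: intersections of at most `κ` internal sets. -/
def IsPiSet (U : NonstandardUniverse.{v}) (κ : Cardinal.{v + 1}) (S : Set ZFSet.{v}) : Prop :=
  ∃ 𝓕 : Set ZFSet.{v}, 𝓕.Nonempty ∧ (∀ F ∈ 𝓕, U.IsInternalSet F) ∧ #𝓕 ≤ κ ∧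
    S = {x | ∀ F ∈ 𝓕, x ∈ F}

/-- A binary operation on `T` is internal if its graph is an internal set. -/
def IsInternalOp (U : NonstandardUniverse.{v}) (T : ZFSet.{v})
    (op : {x // x ∈ T} → {x // x ∈ T} → {x // x ∈ T}) : Prop :=
  ∃ G, U.IsInternalSet G ∧
    ∀ w, w ∈ G ↔ ∃ x y : {x // x ∈ T}, w = ZFSet.pair (ZFSet.pair x.1 y.1) (op x y).1

/-- A hyperfinite associative ring (not necessarily commutative or unital): a hyperfinite set with
internal operations `+` and `*` that satisfy the ring axioms. By transfer these are exactly the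
elements of `*𝒦`, for `𝒦` the class of finite associative rings. -/
structure HyperfiniteRing (U : NonstandardUniverse.{v}) where
  carrier : ZFSet.{v}
  isHyperfinite : U.IsHyperfinite carrier
  ring : NonUnitalRing {x // x ∈ carrier}
  internal_add : U.IsInternalOp carrier (fun a b => a + b)
  internal_mul : U.IsInternalOp carrier (fun a b => a * b)

/-- The underlying type of a hyperfinite ring. -/
abbrev HyperfiniteRing.Elem {U : NonstandardUniverse.{v}} (R : U.HyperfiniteRing) :=
  {x // x ∈ R.carrier}

instance {U : NonstandardUniverse.{v}} (R : U.HyperfiniteRing) : NonUnitalRing R.Elem := R.ring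

/-- A hyperfinite topological triple `⟨R, R_b, ρ⟩` in the signature `⟨+, ×⟩` whose algebra `R` is a
hyperfinite ring: `R_b` is a `σ`-subset of `R` closed under `+` and `×`, and `ρ` is a
`π`-equivalence relation on `R` such that `R_b` is `ρ`-saturated and the restriction of `ρ` to
`R_b` is a congruence. -/
structure RingTriple (U : NonstandardUniverse.{v}) (κ : Cardinal.{v + 1}) where
  R : U.HyperfiniteRing
  feasible : Set R.Elem
  rho : Setoid R.Elem
  sigma_feasible : U.IsSigmaSet κ (Subtype.val '' feasible)
  pi_rho : U.IsPiSet κ {w | ∃ x y : R.Elem, rho x y ∧ w = ZFSet.pair x.1 y.1}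
  feasible_of_rho : ∀ a b, a ∈ feasible → rho a b → b ∈ feasible
  add_mem : ∀ a b, a ∈ feasible → b ∈ feasible → a + b ∈ feasible
  mul_mem : ∀ a b, a ∈ feasible → b ∈ feasible → a * b ∈ feasible
  add_congr : ∀ a a' b b', a ∈ feasible → a' ∈ feasible → b ∈ feasible → b' ∈ feasible →
    rho a a' → rho b b' → rho (a + b) (a' + b')
  mul_congr : ∀ a a' b b', a ∈ feasible → a' ∈ feasible → b ∈ feasible → b' ∈ feasible →
    rho a a' → rho b b' → rho (a * b) (a' * b')

namespace RingTriple

variable {U : NonstandardUniverse.{v}} {κ : Cardinal.{v + 1}} (τ : U.RingTriple κ)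

/-- The restriction of `ρ` to the feasible elements. -/
def feasibleSetoid : Setoid τ.feasible := τ.rho.comap Subtype.val

/-- The quotient `R_b / ρ`. -/
def Hat := Quotient τ.feasibleSetoid

/-- The class `a^ρ` of a feasible element. -/
def toHat (a : τ.feasible) : τ.Hat := Quotient.mk τ.feasibleSetoid a

instance : Add τ.Hat :=
  ⟨Quotient.map₂ (fun a b => ⟨a.1 + b.1, τ.add_mem _ _ a.2 b.2⟩)
    (fun a a' ha b b' hb => τ.add_congr _ _ _ _ a.2 a'.2 b.2 b'.2 ha hb)⟩

instance : Mul τ.Hat :=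
  ⟨Quotient.map₂ (fun a b => ⟨a.1 * b.1, τ.mul_mem _ _ a.2 b.2⟩)
    (fun a a' ha b b' hb => τ.mul_congr _ _ _ _ a.2 a'.2 b.2 b'.2 ha hb)⟩

/-- For a subset `F` of `R_b`, the set `i(F)^ρ` of the classes that are contained in `F`. -/
def classesIn (F : ZFSet.{v}) : Set τ.Hat :=
  {q | ∀ b : τ.feasible, τ.toHat b = q → b.1.1 ∈ F}

/-- The topology on `R_b / ρ` in which the sets `i(F)^ρ` that contain a point, with `F` ranging over
the internal subsets of `R_b`, form a base of neighbourhoods of this point. -/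
instance : TopologicalSpace τ.Hat :=
  TopologicalSpace.generateFrom
    {V | ∃ F : ZFSet.{v}, U.IsInternalSet F ∧ (∀ x ∈ F, x ∈ Subtype.val '' τ.feasible) ∧
      V = τ.classesIn F}

end RingTriple

/-- A topological algebra `K` of signature `⟨+, ×⟩` is abstractly approximable by finite associative
rings if it is topologically isomorphic to `R_b / ρ` for some hyperfinite topological triple
`⟨R, R_b, ρ⟩` whose algebra `R` is a hyperfinite associative ring. -/
def AbstractlyApproximableByFiniteRings (U : NonstandardUniverse.{v}) (κ : Cardinal.{v + 1})
    (K : Type u) [Add K] [Mul K] [TopologicalSpace K] : Prop :=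
  ∃ (τ : U.RingTriple κ) (f : τ.Hat ≃ₜ K),
    (∀ a b, f (a + b) = f a + f b) ∧ (∀ a b, f (a * b) = f a * f b)

end NonstandardUniverse

open BoundedSetFormula Function

/-! ### Superstructures -/

/-! The contradiction lives in the multiplicative semigroup of the hyperfinite ring `R`. Write `st`
for the map from `R_b` onto `K`. Pick an internal `V ⊆ R_b` which contains the class of `1` and
misses the class of `0` (`exists_internalSet_separating`, by saturation). Among the internal right
ideals of `R` that meet `V` there is a minimal one, `M`, because this is so in finite semigroups. If
`y ∈ M` and `yM` meets `V`, then `yM ⊆ M` is again such an ideal, so `yM = M`; by hyperfiniteness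
left multiplication by `y` permutes `M`, and it cannot map an internal subset of `M` onto a proper
part of itself (`exists_rightIdeal_of_finite`, transferred in `exists_internal_rightIdeal`).

Since `M` contains some `m ∈ V` with `st m ≠ 0`, it contains `m R_b`, hence representatives of all
elements of `K`. Let `F ⊆ R_b` be an internal neighbourhood of `0`, and let `z ∈ F ∩ M` have `st z ≠
0`. Every `y ∈ M` with `st y = 0` maps `F ∩ M` into `(F ∩ M) \ {z}`. This property of `y` is
internal, so it defines a neighbourhood of `0`, and as `K` is not discrete it also holds for some `y
∈ M` with `st y ≠ 0`. But then `M` contains a representative `c` of `(st y)⁻¹`, and `yc ∈ V`, so `y`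
permutes `M`: a contradiction.

The preliminary work encodes the required statements as bounded formulas, with care for atoms, and
transfers them with internal parameters. -/

theorem superLevel_subset_succ (Z : ZFSet.{v}) (n : ℕ) : superLevel Z n ⊆ superLevel Z (n + 1) :=
  fun _ hx => ZFSet.mem_union.2 (Or.inl hx)

theorem superLevel_mono (Z : ZFSet.{v}) {m n : ℕ} (h : m ≤ n) :
    superLevel Z m ⊆ superLevel Z n := by
  induction h with
  | refl => exact fun _ hx => hx
  | step _ ih => exact fun _ hx => superLevel_subset_succ Z _ (ih hx)

theorem mem_superLevel_succ_of_subset {Z x : ZFSet.{v}} {n : ℕ} (h : x ⊆ superLevel Z n) :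
    x ∈ superLevel Z (n + 1) :=
  ZFSet.mem_union.2 (Or.inr (ZFSet.mem_powerset.2 h))

theorem subset_superLevel {Z x : ZFSet.{v}} {n : ℕ} (h : x ∈ superLevel Z n) (hx : x ∉ Z) :
    x ⊆ superLevel Z n := by
  induction n with
  | zero => exact absurd h hx
  | succ n ih =>
    rcases ZFSet.mem_union.1 h with h | h
    · exact fun y hy => superLevel_subset_succ Z n (ih h hy)
    · exact fun y hy => superLevel_subset_succ Z n (ZFSet.mem_powerset.1 h hy)

theorem superLevel_mem_superstructure (Z : ZFSet.{v}) (n : ℕ) :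
    superLevel Z n ∈ superstructure Z :=
  ⟨n + 1, mem_superLevel_succ_of_subset fun _ h => h⟩

theorem mem_superstructure_of_mem {Z x y : ZFSet.{v}} (hx : x ∈ superstructure Z) (hZ : x ∉ Z)
    (hy : y ∈ x) : y ∈ superstructure Z :=
  let ⟨n, hn⟩ := hx
  ⟨n, subset_superLevel hn hZ hy⟩

theorem mem_superstructure_of_subset {Z x y : ZFSet.{v}} (hx : x ∈ superstructure Z) (hZ : x ∉ Z)
    (hy : y ⊆ x) : y ∈ superstructure Z :=
  let ⟨n, hn⟩ := hx
  ⟨n + 1, mem_superLevel_succ_of_subset fun _ h => subset_superLevel hn hZ (hy h)⟩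

theorem insert_singleton_mem_superstructure {Z x y : ZFSet.{v}} (hx : x ∈ superstructure Z)
    (hy : y ∈ superstructure Z) : ({x, y} : ZFSet.{v}) ∈ superstructure Z := by
  obtain ⟨m, hm⟩ := hx
  obtain ⟨n, hn⟩ := hy
  refine ⟨max m n + 1, mem_superLevel_succ_of_subset fun z hz => ?_⟩
  rcases ZFSet.mem_pair.1 hz with rfl | rfl
  · exact superLevel_mono Z (le_max_left _ _) hm
  · exact superLevel_mono Z (le_max_right _ _) hn

theorem singleton_mem_superstructure {Z x : ZFSet.{v}} (hx : x ∈ superstructure Z) :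
    ({x} : ZFSet.{v}) ∈ superstructure Z := by
  simpa [ZFSet.pair_eq_singleton] using insert_singleton_mem_superstructure hx hx

theorem pair_mem_superstructure {Z x y : ZFSet.{v}} (hx : x ∈ superstructure Z)
    (hy : y ∈ superstructure Z) : ZFSet.pair x y ∈ superstructure Z :=
  insert_singleton_mem_superstructure (singleton_mem_superstructure hx)
    (insert_singleton_mem_superstructure hx hy)

/-! ### Entities of a superstructure and satisfaction of bounded formulas by them -/

/-- The entities of the superstructure over `Z`. -/
abbrev Ent (Z : ZFSet.{v}) := {x : ZFSet.{v} // x ∈ superstructure Z}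

theorem IsBaseSet.not_mem_of_mem {Z : ZFSet.{v}} (hZ : IsBaseSet Z) {a b : Ent Z}
    (h : b.1 ∈ a.1) : a.1 ∉ Z :=
  fun ha => hZ.2 _ ha _ b.2 h

/-- Extensionality as bounded formulas see it. Atoms must be excluded: no entity belongs to them, so
they are indistinguishable from `∅` by their entity members. -/
theorem Ent.eq_of_forall_mem_iff {Z : ZFSet.{v}} {a : Ent Z} {b : ZFSet.{v}} (ha : a.1 ∉ Z)
    (hb : ∀ y ∈ b, y ∈ superstructure Z) (h : ∀ y : Ent Z, y.1 ∈ a.1 ↔ y.1 ∈ b) : a.1 = b := by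
  ext y
  exact ⟨fun hy => (h ⟨y, mem_superstructure_of_mem a.2 ha hy⟩).1 hy, fun hy => (h ⟨y, hb y hy⟩).2 hy⟩

theorem Ent.eq_singleton_iff {Z : ZFSet.{v}} (hZ : IsBaseSet Z) {s x : Ent Z} :
    (x.1 ∈ s.1 ∧ ∀ u : Ent Z, u.1 ∈ s.1 → u = x) ↔ s.1 = {x.1} := by
  constructor
  · rintro ⟨hx, h⟩
    refine Ent.eq_of_forall_mem_iff (hZ.not_mem_of_mem hx) ?_ fun y => ?_
    · intro y hy
      rw [ZFSet.mem_singleton.1 hy]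
      exact x.2
    · rw [ZFSet.mem_singleton]
      exact ⟨fun hy => congrArg _ (h y hy), fun hy => hy ▸ hx⟩
  · intro h
    simp only [h, ZFSet.mem_singleton, true_and]
    exact fun u hu => Subtype.ext hu

theorem Ent.eq_doubleton_iff {Z : ZFSet.{v}} (hZ : IsBaseSet Z) {s x y : Ent Z} :
    (x.1 ∈ s.1 ∧ y.1 ∈ s.1 ∧ ∀ u : Ent Z, u.1 ∈ s.1 → u = x ∨ u = y) ↔ s.1 = {x.1, y.1} := by
  constructor
  · rintro ⟨hx, hy, h⟩
    refine Ent.eq_of_forall_mem_iff (hZ.not_mem_of_mem hx) ?_ fun u => ?_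
    · intro u hu
      rcases ZFSet.mem_pair.1 hu with rfl | rfl
      exacts [x.2, y.2]
    · rw [ZFSet.mem_pair]
      refine ⟨fun hu => (h u hu).imp (congrArg _) (congrArg _), ?_⟩
      rintro (hu | hu)
      exacts [hu ▸ hx, hu ▸ hy]
  · intro h
    simp only [h, ZFSet.mem_pair, true_or, or_true, true_and]
    exact fun u hu => hu.imp Subtype.ext Subtype.ext

/-! ### Bounded formulas for ordered pairs and graphs -/

namespace BoundedSetFormula

/-- Satisfaction of a bounded formula in the superstructure over `Z`. -/
def Holds {Z : ZFSet.{v}} : BoundedSetFormula → (ℕ → Ent Z) → Prop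
  | .eq i j, v => v i = v j
  | .mem i j, v => (v i).1 ∈ (v j).1
  | .neg φ, v => ¬ φ.Holds v
  | .and φ ψ, v => φ.Holds v ∧ ψ.Holds v
  | .bex i j φ, v => ∃ y : Ent Z, y.1 ∈ (v j).1 ∧ φ.Holds (Function.update v i y)

theorem sat_iff_holds {Z : ZFSet.{v}} (φ : BoundedSetFormula) (v : ℕ → Ent Z) :
    φ.Sat (superstructure Z) (fun i => (v i).1) ↔ φ.Holds v := by
  induction φ generalizing v with
  | eq i j => exact Subtype.ext_iff.symm
  | mem i j => exact Iff.rfl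
  | neg φ ih => exact not_congr (ih v)
  | and φ ψ ih₁ ih₂ => exact and_congr (ih₁ v) (ih₂ v)
  | bex i j φ ih =>
    have key : ∀ y : Ent Z, Function.update (fun i => (v i).1) i y.1 =
        fun k => (Function.update v i y k).1 := by
      intro y
      funext k
      by_cases hk : k = i
      · subst hk; simp
      · simp [hk]
    constructor
    · rintro ⟨y, hy, hyj, h⟩
      refine ⟨⟨y, hy⟩, hyj, (ih _).1 ?_⟩
      rw [← key ⟨y, hy⟩]
      exact h
    · rintro ⟨y, hyj, h⟩
      refine ⟨y.1, y.2, hyj, ?_⟩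
      rw [key y]
      exact (ih _).2 h

/-- Implication. -/
def imp (φ ψ : BoundedSetFormula) : BoundedSetFormula := neg (and φ (neg ψ))

/-- Disjunction. -/
def or (φ ψ : BoundedSetFormula) : BoundedSetFormula := neg (and (neg φ) (neg ψ))

/-- Bounded universal quantification. -/
def ball (i j : ℕ) (φ : BoundedSetFormula) : BoundedSetFormula := neg (bex i j (neg φ))

section Holds

variable {Z : ZFSet.{v}} (φ ψ : BoundedSetFormula) (v : ℕ → Ent Z) (i j : ℕ)

@[simp] theorem holds_eq : (eq i j).Holds v ↔ v i = v j := Iff.rfl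

@[simp] theorem holds_mem : (mem i j).Holds v ↔ (v i).1 ∈ (v j).1 := Iff.rfl

@[simp] theorem holds_neg : (neg φ).Holds v ↔ ¬ φ.Holds v := Iff.rfl

@[simp] theorem holds_and : (and φ ψ).Holds v ↔ φ.Holds v ∧ ψ.Holds v := Iff.rfl

@[simp] theorem holds_bex : (bex i j φ).Holds v ↔
    ∃ y : Ent Z, y.1 ∈ (v j).1 ∧ φ.Holds (Function.update v i y) := Iff.rfl

@[simp] theorem holds_imp : (imp φ ψ).Holds v ↔ (φ.Holds v → ψ.Holds v) := by
  simp [imp]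

@[simp] theorem holds_or : (or φ ψ).Holds v ↔ (φ.Holds v ∨ ψ.Holds v) := by
  simp [or, or_iff_not_and_not]

@[simp] theorem holds_ball : (ball i j φ).Holds v ↔
    ∀ y : Ent Z, y.1 ∈ (v j).1 → φ.Holds (Function.update v i y) := by
  simp only [ball, holds_neg, holds_bex, not_exists, not_and, not_not]

end Holds

/-- The formula `xₚ = (xᵢ, xⱼ)`; it uses the variables from `100` on for its quantifiers. -/
def isPair (p i j : ℕ) : BoundedSetFormula :=
  bex 100 p (bex 101 p
    (and (and (mem i 100) (ball 102 100 (eq 102 i)))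
      (and (and (mem i 101) (and (mem j 101) (ball 102 101 (or (eq 102 i) (eq 102 j)))))
        (ball 102 p (or (eq 102 100) (eq 102 101))))))

/-- The formula `(xᵢ, xⱼ) ∈ xₖ`; it uses the variables from `90` on for its quantifiers. -/
def pairMem (i j k : ℕ) : BoundedSetFormula := bex 90 k (isPair 90 i j)

/-- The formula `((xᵢ, xⱼ), xₖ) ∈ xₗ`; it uses the variables from `90` on for its quantifiers. -/
def tripleMem (i j k l : ℕ) : BoundedSetFormula :=
  bex 90 l (bex 91 90 (bex 92 91 (and (isPair 92 i j) (isPair 90 92 k))))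

theorem holds_isPair {Z : ZFSet.{v}} (hZ : IsBaseSet Z) (v : ℕ → Ent Z) {p i j : ℕ}
    (hp : p < 100) (hi : i < 100) (hj : j < 100) :
    (isPair p i j).Holds v ↔ (v p).1 = ZFSet.pair (v i).1 (v j).1 := by
  have h : ∀ n < 100, n ≠ 100 ∧ n ≠ 101 ∧ n ≠ 102 := by omega
  obtain ⟨p0, p1, -⟩ := h p hp
  obtain ⟨i0, i1, i2⟩ := h i hi
  obtain ⟨j0, j1, j2⟩ := h j hj
  simp only [isPair, holds_bex, holds_and, holds_mem, holds_ball, holds_eq, holds_or,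
    Function.update_apply, p0, p1, i0, i1, i2, j0, j1, j2, if_false, if_true,
    Ent.eq_singleton_iff hZ, Ent.eq_doubleton_iff hZ, Nat.reduceEqDiff]
  constructor
  · rintro ⟨s, hs, t, ht, h1, h2, h3⟩
    rw [ZFSet.pair, ← h1, ← h2]
    exact (Ent.eq_doubleton_iff hZ).1 ⟨hs, ht, h3⟩
  · intro h
    -- The quantifiers range over entities only, so the two components of the Kuratowski pair must
    -- be entities as well.
    have hs := singleton_mem_superstructure (v i).2
    have ht := insert_singleton_mem_superstructure (v i).2 (v j).2
    obtain ⟨h1, h2, h3⟩ := (Ent.eq_doubleton_iff hZ (s := v p) (x := ⟨_, hs⟩) (y := ⟨_, ht⟩)).2 h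
    exact ⟨⟨_, hs⟩, h1, ⟨_, ht⟩, h2, rfl, rfl, h3⟩

theorem holds_pairMem {Z : ZFSet.{v}} (hZ : IsBaseSet Z) (v : ℕ → Ent Z) {i j k : ℕ}
    (hi : i < 90) (hj : j < 90) :
    (pairMem i j k).Holds v ↔ ZFSet.pair (v i).1 (v j).1 ∈ (v k).1 := by
  rw [pairMem, holds_bex]
  simp only [holds_isPair hZ _ (show 90 < 100 by norm_num) (show i < 100 by omega)
    (show j < 100 by omega), Function.update_apply, hi.ne, hj.ne, if_true, if_false]
  constructor
  · rintro ⟨y, hy, h⟩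
    exact h ▸ hy
  · intro h
    exact ⟨⟨_, pair_mem_superstructure (v i).2 (v j).2⟩, h, rfl⟩

theorem holds_tripleMem {Z : ZFSet.{v}} (hZ : IsBaseSet Z) (v : ℕ → Ent Z) {i j k l : ℕ}
    (hi : i < 90) (hj : j < 90) (hk : k < 90) :
    (tripleMem i j k l).Holds v ↔
      ZFSet.pair (ZFSet.pair (v i).1 (v j).1) (v k).1 ∈ (v l).1 := by
  have h1 : ∀ n < 90, n ≠ 91 ∧ n ≠ 92 := by omega
  simp only [tripleMem, holds_bex, holds_and,
    holds_isPair hZ _ (show 90 < 100 by norm_num) (show 92 < 100 by norm_num)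
    (show k < 100 by omega), holds_isPair hZ _ (show 92 < 100 by norm_num) (show i < 100 by omega)
    (show j < 100 by omega), Function.update_apply, hi.ne, hj.ne, hk.ne, h1 i hi, h1 j hj, h1 k hk,
    if_true, if_false, Nat.reduceEqDiff]
  constructor
  · rintro ⟨w, hw, s, hs, q, hq, h2, h3⟩
    rw [← h2, ← h3]
    exact hw
  · intro h
    have hq := pair_mem_superstructure (v i).2 (v j).2
    -- The inner pair `q` is not a member of the triple `(q, x)` but of its member `{q}`, which
    -- bounds the quantifier over `q`.
    refine ⟨⟨_, pair_mem_superstructure hq (v k).2⟩, h, ⟨_, singleton_mem_superstructure hq⟩, ?_,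
      ⟨_, hq⟩, ?_, rfl, rfl⟩
    · exact ZFSet.mem_pair.2 (Or.inl rfl)
    · exact ZFSet.mem_singleton.2 rfl

end BoundedSetFormula

/-- An atom is non-empty and none of its elements is an entity. This covers `x = ∅` too, thanks to
`∅ ∉ Z`. -/
theorem IsBaseSet.not_mem_of_subset {Z x : ZFSet.{v}} (hZ : IsBaseSet Z)
    (h : ∀ y ∈ x, y ∈ superstructure Z) : x ∉ Z := by
  intro hx
  rcases x.eq_empty_or_nonempty with rfl | ⟨y, hy⟩
  · exact hZ.1 hx
  · exact hZ.2 x hx y (h y hy) hy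

theorem IsBaseSet.superLevel_not_mem {Z : ZFSet.{v}} (hZ : IsBaseSet Z) (n : ℕ) :
    superLevel Z n ∉ Z :=
  hZ.not_mem_of_subset fun _ hy => ⟨n, hy⟩

/-- The superstructure level `Vₙ(Z)` as an entity. -/
def levelEnt (Z : ZFSet.{v}) (n : ℕ) : Ent Z := ⟨_, superLevel_mem_superstructure Z n⟩

/-- The assignment with values `a₀, …, a₄` at the first five variables and given by `r` at the
others. -/
def assign {α : Type*} (a₀ a₁ a₂ a₃ a₄ : α) (r : ℕ → α) : ℕ → α
  | 0 => a₀
  | 1 => a₁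
  | 2 => a₂
  | 3 => a₃
  | 4 => a₄
  | n + 5 => r (n + 5)

/-! ### Transfer with internal parameters and the internal definition principle -/

namespace NonstandardUniverse

variable (U : NonstandardUniverse.{v})

/-- The map `*` on entities. -/
def starEnt (a : Ent U.X) : Ent U.Y := ⟨U.star a.1, U.star_mem _ a.2⟩

theorem transfer_holds (φ : BoundedSetFormula) (v : ℕ → Ent U.X) :
    φ.Holds v ↔ φ.Holds (fun i => U.starEnt (v i)) := by
  rw [← sat_iff_holds, ← sat_iff_holds]
  exact U.transfer φ _ fun i => (v i).2

/-- Transfer of a formula that holds whenever its first `k` variables are in a standard set `B` and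
the other variables have constant values. -/
theorem holds_of_forall_mem (φ : BoundedSetFormula) (c : ℕ → Ent U.X) {k j : ℕ} (hkj : k ≤ j)
    (h : ∀ v : ℕ → Ent U.X, (∀ i < k, (v i).1 ∈ (c j).1) → (∀ i, k ≤ i → v i = c i) → φ.Holds v)
    (w : ℕ → Ent U.Y) (hw : ∀ i < k, (w i).1 ∈ U.star (c j).1)
    (hw' : ∀ i, k ≤ i → w i = U.starEnt (c i)) : φ.Holds w := by
  induction k generalizing φ w with
  | zero =>
    have : w = fun i => U.starEnt (c i) := funext fun i => hw' i i.zero_le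
    rw [this]
    exact (U.transfer_holds φ c).1 (h c (by simp) fun _ _ => rfl)
  | succ k ih =>
    -- The last free parameter is turned into a bounded quantifier over `B`. Its slot then has no
    -- influence, and gets a standard value only to meet the induction hypothesis.
    have key := ih (ball k j φ) (by omega) (fun v hv hv' => ?_) (update w k (U.starEnt (c k)))
      (fun i hi => ?_) (fun i hi => ?_)
    · rw [holds_ball] at key
      have := key (w k) (by
        rw [update_of_ne (by omega), hw' j hkj]
        exact hw k (by omega))
      simpa using this
    · rw [holds_ball]
      intro y hy
      refine h _ (fun i hi => ?_) fun i hi => ?_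
      · rcases eq_or_ne i k with rfl | hik
        · rw [update_self, ← hv' j (by omega)]
          exact hy
        · rw [update_of_ne hik]
          exact hv i (by omega)
      · rw [update_of_ne (by omega)]
        exact hv' i (by omega)
    · rw [update_of_ne hi.ne]
      exact hw i (by omega)
    · rcases eq_or_ne i k with rfl | hik
      · rw [update_self]
      · rw [update_of_ne hik]
        exact hw' i (by omega)

/-- Internal entities: elements of `*A` for a standard set `A`. -/
def IsInternalEnt (a : Ent U.Y) : Prop := ∃ n, a.1 ∈ U.star (superLevel U.X n)

variable {U}

theorem star_not_mem {A : ZFSet.{v}} (hA : A ∈ superstructure U.X) (h : A ∉ U.X) :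
    U.star A ∉ U.Y := by
  have := (U.transfer_holds (mem 0 1) (fun i => if i = 0 then ⟨A, hA⟩ else levelEnt U.X 0)).not.1 h
  rwa [← U.star_X]

theorem star_subset {A B : Ent U.X} (h : A.1 ⊆ B.1) {y : Ent U.Y} (hy : y.1 ∈ U.star A.1) :
    y.1 ∈ U.star B.1 := by
  have := (U.transfer_holds (ball 0 1 (mem 0 2)) (fun i => if i = 1 then A else B)).1 (by
    simpa [update_apply] using fun y _ hy => h hy)
  simp only [holds_ball, holds_mem, update_apply] at this
  exact this y hy

theorem star_superLevel_mono {m n : ℕ} (h : m ≤ n) {y : Ent U.Y}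
    (hy : y.1 ∈ U.star (superLevel U.X m)) : y.1 ∈ U.star (superLevel U.X n) :=
  star_subset (A := levelEnt U.X m) (B := levelEnt U.X n) (superLevel_mono _ h) hy

theorem mem_superstructure_of_mem_star {A y : ZFSet.{v}} (hA : A ∈ superstructure U.X)
    (h : A ∉ U.X) (hy : y ∈ U.star A) : y ∈ superstructure U.Y :=
  mem_superstructure_of_mem (U.star_mem A hA) (star_not_mem hA h) hy

theorem isInternalEnt_of_mem_star {A y : ZFSet.{v}} (hA : A ∈ superstructure U.X)
    (h : A ∉ U.X) (hy : y ∈ U.star A) :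
    U.IsInternalEnt ⟨y, mem_superstructure_of_mem_star hA h hy⟩ := by
  obtain ⟨n, hn⟩ := hA
  exact ⟨n, star_subset (A := ⟨A, n, hn⟩) (B := levelEnt U.X n)
    (y := ⟨y, mem_superstructure_of_mem_star ⟨n, hn⟩ h hy⟩) (subset_superLevel hn h) hy⟩

/-- Each level is transitive up to atoms, which have no entities as members; this transfers to the
sets `*Vₙ(X)`. -/
theorem IsInternalEnt.of_mem {x y : Ent U.Y} (hx : U.IsInternalEnt x) (hy : y.1 ∈ x.1) :
    U.IsInternalEnt y := by
  obtain ⟨n, hn⟩ := hx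
  have := (U.transfer_holds (ball 0 5 (ball 1 0 (mem 1 5))) (fun _ => levelEnt U.X n)).1 (by
    simp only [holds_ball, holds_mem, update_apply, levelEnt]
    intro x hx y hy
    exact subset_superLevel hx (U.isBaseSet_X.not_mem_of_mem hy) hy)
  simp only [holds_ball, holds_mem, update_apply] at this
  exact ⟨n, this x hn y hy⟩

theorem IsInternalSet.mem_superstructure {S : ZFSet.{v}} (hS : U.IsInternalSet S) :
    S ∈ superstructure U.Y :=
  let ⟨_, hA, h, hSA⟩ := hS.2
  mem_superstructure_of_mem_star hA h hSA

theorem IsInternalSet.isInternalEnt {S : ZFSet.{v}} (hS : U.IsInternalSet S) :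
    U.IsInternalEnt ⟨S, hS.mem_superstructure⟩ :=
  let ⟨_, hA, h, hSA⟩ := hS.2
  isInternalEnt_of_mem_star hA h hSA

theorem IsInternalEnt.isInternalSet {S : Ent U.Y} (hS : U.IsInternalEnt S) (h : S.1 ∉ U.Y) :
    U.IsInternalSet S.1 :=
  let ⟨n, hn⟩ := hS
  ⟨h, _, superLevel_mem_superstructure U.X n, U.isBaseSet_X.superLevel_not_mem n, hn⟩

theorem IsInternalSet.mem_superstructure_of_mem {S y : ZFSet.{v}} (hS : U.IsInternalSet S)
    (hy : y ∈ S) : y ∈ superstructure U.Y :=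
  _root_.mem_superstructure_of_mem hS.mem_superstructure hS.1 hy

theorem IsInternalSet.isInternalEnt_of_mem {S : ZFSet.{v}} {y : Ent U.Y} (hS : U.IsInternalSet S)
    (hy : y.1 ∈ S) : U.IsInternalEnt y :=
  hS.isInternalEnt.of_mem hy

theorem exists_forall_mem_star_superLevel {a₀ a₁ a₂ a₃ a₄ : Ent U.Y} (h₀ : U.IsInternalEnt a₀)
    (h₁ : U.IsInternalEnt a₁) (h₂ : U.IsInternalEnt a₂) (h₃ : U.IsInternalEnt a₃)
    (h₄ : U.IsInternalEnt a₄) (r : ℕ → Ent U.Y) :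
    ∃ n, ∀ i < 5, (assign a₀ a₁ a₂ a₃ a₄ r i).1 ∈ U.star (superLevel U.X n) := by
  obtain ⟨n₀, h₀⟩ := h₀
  obtain ⟨n₁, h₁⟩ := h₁
  obtain ⟨n₂, h₂⟩ := h₂
  obtain ⟨n₃, h₃⟩ := h₃
  obtain ⟨n₄, h₄⟩ := h₄
  refine ⟨n₀ + n₁ + n₂ + n₃ + n₄, fun i hi => ?_⟩
  match i, hi with
  | 0, _ => exact star_superLevel_mono (by omega) h₀
  | 1, _ => exact star_superLevel_mono (by omega) h₁
  | 2, _ => exact star_superLevel_mono (by omega) h₂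
  | 3, _ => exact star_superLevel_mono (by omega) h₃
  | 4, _ => exact star_superLevel_mono (by omega) h₄

theorem assign_of_le {α : Type*} (a₀ a₁ a₂ a₃ a₄ : α) (r : ℕ → α) {i : ℕ} (hi : 5 ≤ i) :
    assign a₀ a₁ a₂ a₃ a₄ r i = r i := by
  obtain ⟨n, rfl⟩ := Nat.exists_eq_add_of_le' hi
  rfl

/-- The internal definition principle. The formula `φ` may use the variables `0, …, 4` for the
parameters and `20` for the element, but not `21` and `22` as free variables. -/
theorem exists_internalSet_sep (φ : BoundedSetFormula)
    (hφ : ∀ (v : ℕ → Ent U.X) (S : Ent U.X), φ.Holds (update v 21 S) ↔ φ.Holds v)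
    (hφ' : ∀ (v : ℕ → Ent U.Y) (S : Ent U.Y), φ.Holds (update v 21 S) ↔ φ.Holds v)
    {a₀ a₁ a₂ a₃ a₄ : Ent U.Y} (h₀ : U.IsInternalEnt a₀)
    (h₁ : U.IsInternalEnt a₁) (h₂ : U.IsInternalEnt a₂) (h₃ : U.IsInternalEnt a₃)
    (h₄ : U.IsInternalEnt a₄) :
    ∃ (r : ℕ → Ent U.Y) (S : ZFSet.{v}), U.IsInternalSet S ∧
      ∀ y : Ent U.Y, y.1 ∈ S ↔ y.1 ∈ a₀.1 ∧ φ.Holds (update (assign a₀ a₁ a₂ a₃ a₄ r) 20 y) := by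
  obtain ⟨n, hn⟩ := exists_forall_mem_star_superLevel h₀ h₁ h₂ h₃ h₄ fun _ => a₀
  -- Variable 5 bounds the parameters, variable 6 bounds the set to be defined, which is one level
  -- higher, and variable 7 is the set of atoms. The last clause of the formula below is needed
  -- because an atom has the same entity members as an empty `S`.
  let c : ℕ → Ent U.X := fun i =>
    if i = 5 then levelEnt U.X n else if i = 6 then levelEnt U.X (n + 1) else levelEnt U.X 0
  have key := U.holds_of_forall_mem (k := 5) (j := 5)
    (bex 21 6 (and (and (ball 20 0 (imp φ (mem 20 21))) (ball 20 21 (and (mem 20 0) φ)))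
      (ball 22 7 (neg (eq 22 21))))) c le_rfl (fun v hv hv' => ?_)
    (assign a₀ a₁ a₂ a₃ a₄ fun i => U.starEnt (c i)) (fun i hi => ?_) (fun i hi => ?_)
  · refine ⟨fun i => U.starEnt (c i), ?_⟩
    generalize hw : assign a₀ a₁ a₂ a₃ a₄ (fun i => U.starEnt (c i)) = w at key ⊢
    have comm : ∀ (w : ℕ → Ent U.Y) S y,
        φ.Holds (update (update w 21 S) 20 y) ↔ φ.Holds (update w 20 y) := fun w S y => by
      rw [update_comm (by norm_num), hφ']
    have w0 : w 0 = a₀ := by rw [← hw]; rfl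
    have w6 : (w 6).1 = U.star (superLevel U.X (n + 1)) := by rw [← hw]; rfl
    have w7 : (w 7).1 = U.Y := by rw [← hw]; exact U.star_X
    simp only [holds_bex, holds_and, holds_ball, holds_imp, holds_mem, holds_neg, holds_eq,
      comm] at key
    simp only [update_apply, Nat.reduceEqDiff, if_true, if_false, w0, w6, w7] at key
    obtain ⟨S, hS, ⟨h1, h2⟩, h3⟩ := key
    refine ⟨S.1, IsInternalEnt.isInternalSet ⟨n + 1, hS⟩ fun hSY => h3 S hSY rfl, fun y => ?_⟩
    exact ⟨fun hy => h2 y hy, fun hy => h1 y hy.1 hy.2⟩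
  · have v5 : v 5 = levelEnt U.X n := hv' 5 le_rfl
    have v6 : v 6 = levelEnt U.X (n + 1) := hv' 6 (by norm_num)
    have v7 : (v 7).1 = U.X := by rw [hv' 7 (by norm_num)]; rfl
    have v0 := hv 0 (by norm_num)
    have comm : ∀ (w : ℕ → Ent U.X) S y,
        φ.Holds (update (update w 21 S) 20 y) ↔ φ.Holds (update w 20 y) := fun w S y => by
      rw [update_comm (by norm_num), hφ]
    let S : ZFSet.{v} := (superLevel U.X n).sep fun y =>
      y ∈ (v 0).1 ∧ ∃ hy : y ∈ superstructure U.X, φ.Holds (update v 20 ⟨y, hy⟩)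
    have mem_S : ∀ y, y ∈ S ↔ y ∈ superLevel U.X n ∧ y ∈ (v 0).1 ∧
        ∃ hy : y ∈ superstructure U.X, φ.Holds (update v 20 ⟨y, hy⟩) := fun y => ZFSet.mem_sep
    have hS : S ∈ superLevel U.X (n + 1) :=
      mem_superLevel_succ_of_subset fun y hy => ((mem_S y).1 hy).1
    simp only [holds_bex, holds_and, holds_ball, holds_imp, holds_mem, holds_neg, holds_eq,
      comm]
    simp only [update_apply, Nat.reduceEqDiff, if_true, if_false, v6, v7]
    refine ⟨⟨S, n + 1, hS⟩, hS, ⟨fun y hy h => ?_, fun y hy => ?_⟩, fun y hy h => ?_⟩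
    · exact (mem_S _).2
        ⟨subset_superLevel v0 (U.isBaseSet_X.not_mem_of_mem hy) hy, hy, y.2, h⟩
    · obtain ⟨-, h, _, h'⟩ := (mem_S _).1 hy
      exact ⟨h, h'⟩
    · refine U.isBaseSet_X.not_mem_of_subset (fun z hz => ⟨n, ((mem_S z).1 hz).1⟩) (?_ : S ∈ U.X)
      rwa [h] at hy
  · have := hn i hi
    match i, hi with
    | 0, _ => exact this
    | 1, _ => exact this
    | 2, _ => exact this
    | 3, _ => exact this
    | 4, _ => exact this
  · rw [assign_of_le _ _ _ _ _ _ hi]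

end NonstandardUniverse

/-! ### Minimal right ideals of finite semigroups -/

/-- A finite semigroup `T`, given by the graph `H` of its multiplication, has a right ideal `M` which
meets a given set `V`, and such that left multiplication by an element `y` of `M` with `y M` meeting
`V` does not map any subset of `M` to a proper subset of itself. -/
theorem exists_rightIdeal_of_finite {α : Type*} {T V : Set α} (hT : T.Finite)
    {H : α → α → α → Prop} (total : ∀ x ∈ T, ∀ y ∈ T, ∃ z ∈ T, H x y z)
    (functional : ∀ x ∈ T, ∀ y ∈ T, ∀ z ∈ T, ∀ z' ∈ T, H x y z → H x y z' → z = z')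
    (assoc : ∀ x ∈ T, ∀ y ∈ T, ∀ z ∈ T, ∀ p ∈ T, ∀ q ∈ T, ∀ r ∈ T,
      H x y p → H p z q → H y z r → H x r q)
    (hV : ∃ u ∈ T, u ∈ V) :
    ∃ M ⊆ T, (∀ m ∈ M, ∀ r ∈ T, ∀ s ∈ T, H m r s → s ∈ M) ∧ (∃ m ∈ M, m ∈ V) ∧
      ∀ y ∈ M, (∃ m ∈ M, ∃ u ∈ T, u ∈ V ∧ H y m u) → ∀ F : Set α, ∀ z ∈ M, z ∈ F →
        (∀ x ∈ M, x ∈ F → ∃ p ∈ M, p ∈ F ∧ H y x p) → ∃ x ∈ M, x ∈ F ∧ H y x z := by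
  let J : Set (Set α) :=
    {M | M ⊆ T ∧ (∀ m ∈ M, ∀ r ∈ T, ∀ s ∈ T, H m r s → s ∈ M) ∧ ∃ m ∈ M, m ∈ V}
  have hJ : J.Finite := hT.powerset.subset fun M hM => hM.1
  obtain ⟨M, ⟨hMT, hMr, hMV⟩, hmin⟩ :=
    hJ.exists_minimal ⟨T, subset_rfl, fun _ _ _ _ s hs _ => hs, hV⟩
  refine ⟨M, hMT, hMr, hMV, ?_⟩
  rintro y hy ⟨m₀, hm₀, u, huT, huV, hu⟩ F z hz hzF hF
  -- By associativity `yM` is a right ideal; it lies in `M` and meets `V`, so minimality gives `yM =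
  -- M`.
  have hsurj : ∀ s ∈ M, ∃ m ∈ M, H y m s := by
    have hle : {s ∈ T | ∃ m ∈ M, H y m s} ⊆ M :=
      fun s ⟨hs, m, hm, h⟩ => hMr y hy m (hMT hm) s hs h
    have hmem : {s ∈ T | ∃ m ∈ M, H y m s} ∈ J := by
      refine ⟨fun s hs => hs.1, ?_, u, ⟨huT, m₀, hm₀, hu⟩, huV⟩
      rintro s ⟨hs, m, hm, h⟩ r hr t ht hsrt
      obtain ⟨q, hq, hmq⟩ := total m (hMT hm) r hr
      exact ⟨ht, q, hMr m hm r hr q hq hmq,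
        assoc y (hMT hy) m (hMT hm) r hr s hs t ht q hq h hsrt hmq⟩
    exact fun s hs => (hmin hmem hle hs).2
  have hMfin : Finite M := (hT.subset hMT).to_subtype
  have hfun : ∀ m ∈ M, ∀ s ∈ M, ∀ s' ∈ M, H y m s → H y m s' → s = s' :=
    fun m hm s hs s' hs' => functional y (hMT hy) m (hMT hm) s (hMT hs) s' (hMT hs')
  choose g hgM hg using hsurj
  -- The section `g` of left multiplication by `y` is injective, hence bijective on the finite set
  -- `M`, so left multiplication is its inverse.
  have hinj : ∀ m ∈ M, ∀ m' ∈ M, ∀ s ∈ M, H y m s → H y m' s → m = m' := by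
    let g' : M → M := fun s => ⟨g s.1 s.2, hgM s.1 s.2⟩
    have hg' : Injective g' := by
      intro s t hst
      have h := hg t.1 t.2
      rw [← show g s.1 s.2 = g t.1 t.2 from congrArg Subtype.val hst] at h
      exact Subtype.ext (hfun _ (hgM s.1 s.2) _ s.2 _ t.2 (hg s.1 s.2) h)
    have key : ∀ m ∈ M, ∀ s, ∀ hs : s ∈ M, H y m s → m = g s hs := by
      intro m hm s hs h
      obtain ⟨t, ht⟩ := Finite.surjective_of_injective hg' ⟨m, hm⟩
      have ht' : g t.1 t.2 = m := congrArg Subtype.val ht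
      have h1 := hg t.1 t.2
      rw [ht'] at h1
      obtain rfl := hfun m hm s hs t.1 t.2 h h1
      exact ht'.symm
    intro m hm m' hm' s hs h h'
    rw [key m hm s hs h, key m' hm' s hs h']
  -- Left multiplication by `y` is now an injective self-map of the finite set `M ∩ F`, hence
  -- attains `z`.
  choose p hpM hpF hp using hF
  let N : Set α := {x | x ∈ M ∧ x ∈ F}
  have hN : Finite N := (hT.subset fun x (hx : x ∈ N) => hMT hx.1).to_subtype
  let p' : N → N := fun x => ⟨p x.1 x.2.1 x.2.2, hpM _ _ _, hpF _ _ _⟩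
  have hp' : Injective p' := by
    intro a b hab
    have h := hp b.1 b.2.1 b.2.2
    rw [← show p a.1 a.2.1 a.2.2 = p b.1 b.2.1 b.2.2 from congrArg Subtype.val hab] at h
    exact Subtype.ext (hinj _ a.2.1 _ b.2.1 _ (hpM _ _ _) (hp a.1 a.2.1 a.2.2) h)
  obtain ⟨x, hx⟩ := Finite.surjective_of_injective hp' ⟨z, hz, hzF⟩
  have h := hp x.1 x.2.1 x.2.2
  rw [show p x.1 x.2.1 x.2.2 = z from congrArg Subtype.val hx] at h
  exact ⟨x.1, x.2.1, x.2.2, h⟩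

/-! ### Transfer to hyperfinite semigroups -/

namespace NonstandardUniverse

variable {U : NonstandardUniverse.{v}}

theorem mem_finiteSubsets {A s : ZFSet.{v}} :
    s ∈ finiteSubsets A ↔ s ⊆ A ∧ {x | x ∈ s}.Finite := by
  rw [finiteSubsets, ZFSet.mem_sep, ZFSet.mem_powerset]

theorem finiteSubsets_mem_superstructure {Z A : ZFSet.{v}} (hA : A ∈ superstructure Z)
    (h : A ∉ Z) : finiteSubsets A ∈ superstructure Z := by
  obtain ⟨n, hn⟩ := hA
  exact ⟨n + 2, mem_superLevel_succ_of_subset fun y hy => mem_superLevel_succ_of_subset fun z hz =>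
    subset_superLevel hn h ((mem_finiteSubsets.1 hy).1 hz)⟩

theorem finiteSubsets_not_mem {Z A : ZFSet.{v}} (hZ : IsBaseSet Z) (hA : A ∈ superstructure Z)
    (h : A ∉ Z) : finiteSubsets A ∉ Z :=
  hZ.not_mem_of_subset fun _ hy =>
    mem_superstructure_of_subset hA h (mem_finiteSubsets.1 hy).1

/-- The point is that `T` is not an atom: no finite subset of a standard set is one, and this
transfers. -/
theorem IsHyperfinite.isInternalSet {T : ZFSet.{v}} (hT : U.IsHyperfinite T) :
    U.IsInternalSet T := by
  obtain ⟨A, hA, h, hTA⟩ := hT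
  have hD := finiteSubsets_mem_superstructure hA h
  have hDX := finiteSubsets_not_mem U.isBaseSet_X hA h
  have hTY := isInternalEnt_of_mem_star hD hDX hTA
  refine hTY.isInternalSet fun hT => ?_
  have := (U.transfer_holds (ball 0 1 (neg (mem 0 2)))
    (fun i => if i = 1 then ⟨_, hD⟩ else levelEnt U.X 0)).1 (by
      simp only [holds_ball, holds_neg, holds_mem, update_apply, levelEnt]
      exact fun y hy => U.isBaseSet_X.not_mem_of_subset fun z hz =>
        mem_superstructure_of_mem hA h ((mem_finiteSubsets.1 hy).1 hz))
  simp only [holds_ball, holds_neg, holds_mem, update_apply] at this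
  exact this ⟨T, mem_superstructure_of_mem_star hD hDX hTA⟩ hTA (U.star_X.symm ▸ hT : T ∈ U.star U.X)

/-- The formula for `exists_rightIdeal_of_finite`: the variables `0, …, 3` are the semigroup, the
graph of its multiplication, and the sets `V` and `F`; the variable `6` is a bound for `M`. -/
def rightIdealFormula : BoundedSetFormula :=
  imp (and (mem 0 6) (and
      (ball 11 0 (ball 12 0 (bex 13 0 (tripleMem 11 12 13 1)))) (and
      (ball 11 0 (ball 12 0 (ball 13 0 (ball 14 0 (imp (tripleMem 11 12 13 1)
        (imp (tripleMem 11 12 14 1) (eq 13 14))))))) (and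
      (ball 11 0 (ball 12 0 (ball 13 0 (ball 14 0 (ball 15 0 (ball 16 0 (
        imp (tripleMem 11 12 14 1) (imp (tripleMem 14 13 15 1) (imp (tripleMem 12 13 16 1)
          (tripleMem 11 16 15 1)))))))))) (bex 11 0 (mem 11 2))))))
    (bex 10 6 (and (ball 11 10 (mem 11 0)) (and
      (ball 11 10 (ball 12 0 (ball 13 0 (imp (tripleMem 11 12 13 1) (mem 13 10))))) (and
      (bex 11 10 (mem 11 2))
      (ball 11 10 (imp (bex 12 10 (bex 13 0 (and (mem 13 2) (tripleMem 11 12 13 1))))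
        (ball 12 10 (imp (mem 12 3) (imp
          (ball 13 10 (imp (mem 13 3) (bex 14 10 (and (mem 14 3) (tripleMem 11 13 14 1)))))
          (bex 13 10 (and (mem 13 3) (tripleMem 11 13 12 1))))))))))))

/-- `xy = z` for the multiplication with graph `H`. -/
def GraphRel {Z : ZFSet.{v}} (H x y z : Ent Z) : Prop :=
  ZFSet.pair (ZFSet.pair x.1 y.1) z.1 ∈ H.1

theorem holds_rightIdealFormula {Z : ZFSet.{v}} (hZ : IsBaseSet Z) (v : ℕ → Ent Z) :
    rightIdealFormula.Holds v ↔
      ((v 0).1 ∈ (v 6).1 ∧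
      (∀ x : Ent Z, x.1 ∈ (v 0).1 → ∀ y : Ent Z, y.1 ∈ (v 0).1 →
        ∃ z : Ent Z, z.1 ∈ (v 0).1 ∧ GraphRel (v 1) x y z) ∧
      (∀ x : Ent Z, x.1 ∈ (v 0).1 → ∀ y : Ent Z, y.1 ∈ (v 0).1 → ∀ z : Ent Z, z.1 ∈ (v 0).1 →
        ∀ z' : Ent Z, z'.1 ∈ (v 0).1 → GraphRel (v 1) x y z → GraphRel (v 1) x y z' → z = z') ∧
      (∀ x : Ent Z, x.1 ∈ (v 0).1 → ∀ y : Ent Z, y.1 ∈ (v 0).1 → ∀ z : Ent Z, z.1 ∈ (v 0).1 →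
        ∀ p : Ent Z, p.1 ∈ (v 0).1 → ∀ q : Ent Z, q.1 ∈ (v 0).1 → ∀ r : Ent Z, r.1 ∈ (v 0).1 →
        GraphRel (v 1) x y p → GraphRel (v 1) p z q → GraphRel (v 1) y z r →
          GraphRel (v 1) x r q) ∧
      (∃ u : Ent Z, u.1 ∈ (v 0).1 ∧ u.1 ∈ (v 2).1) →
      ∃ M : Ent Z, M.1 ∈ (v 6).1 ∧ (∀ m : Ent Z, m.1 ∈ M.1 → m.1 ∈ (v 0).1) ∧
        (∀ m : Ent Z, m.1 ∈ M.1 → ∀ r : Ent Z, r.1 ∈ (v 0).1 → ∀ s : Ent Z, s.1 ∈ (v 0).1 →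
          GraphRel (v 1) m r s → s.1 ∈ M.1) ∧
        (∃ m : Ent Z, m.1 ∈ M.1 ∧ m.1 ∈ (v 2).1) ∧
        ∀ y : Ent Z, y.1 ∈ M.1 →
          (∃ m : Ent Z, m.1 ∈ M.1 ∧ ∃ u : Ent Z, u.1 ∈ (v 0).1 ∧ u.1 ∈ (v 2).1 ∧
            GraphRel (v 1) y m u) →
          ∀ z : Ent Z, z.1 ∈ M.1 → z.1 ∈ (v 3).1 →
            (∀ x : Ent Z, x.1 ∈ M.1 → x.1 ∈ (v 3).1 →
              ∃ p : Ent Z, p.1 ∈ M.1 ∧ p.1 ∈ (v 3).1 ∧ GraphRel (v 1) y x p) →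
            ∃ x : Ent Z, x.1 ∈ M.1 ∧ x.1 ∈ (v 3).1 ∧ GraphRel (v 1) y x z) := by
  have T : ∀ (v : ℕ → Ent Z) {i j k l : ℕ} (_ : i < 90) (_ : j < 90) (_ : k < 90),
      (tripleMem i j k l).Holds v ↔ GraphRel (v l) (v i) (v j) (v k) :=
    fun v _ _ _ _ hi hj hk => holds_tripleMem hZ v hi hj hk
  simp (disch := norm_num only) only [rightIdealFormula, holds_imp, holds_and, holds_ball,
    holds_bex, holds_mem, holds_eq, T]
  simp only [update_apply, Nat.reduceEqDiff, if_true, if_false,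
    OfNat.zero_ne_ofNat, OfNat.one_ne_ofNat]

/-- The internal right ideal of a hyperfinite semigroup that is obtained by transfer from
`exists_rightIdeal_of_finite`. -/
theorem exists_internal_rightIdeal {T H V F : Ent U.Y} (hT : U.IsHyperfinite T.1)
    (hH : U.IsInternalEnt H) (hV : U.IsInternalEnt V) (hF : U.IsInternalEnt F)
    (total : ∀ x : Ent U.Y, x.1 ∈ T.1 → ∀ y : Ent U.Y, y.1 ∈ T.1 →
      ∃ z : Ent U.Y, z.1 ∈ T.1 ∧ GraphRel H x y z)
    (functional : ∀ x : Ent U.Y, x.1 ∈ T.1 → ∀ y : Ent U.Y, y.1 ∈ T.1 → ∀ z : Ent U.Y, z.1 ∈ T.1 →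
      ∀ z' : Ent U.Y, z'.1 ∈ T.1 → GraphRel H x y z → GraphRel H x y z' → z = z')
    (assoc : ∀ x : Ent U.Y, x.1 ∈ T.1 → ∀ y : Ent U.Y, y.1 ∈ T.1 → ∀ z : Ent U.Y, z.1 ∈ T.1 →
      ∀ p : Ent U.Y, p.1 ∈ T.1 → ∀ q : Ent U.Y, q.1 ∈ T.1 → ∀ r : Ent U.Y, r.1 ∈ T.1 →
      GraphRel H x y p → GraphRel H p z q → GraphRel H y z r → GraphRel H x r q)
    (hTV : ∃ u : Ent U.Y, u.1 ∈ T.1 ∧ u.1 ∈ V.1) :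
    ∃ M : Ent U.Y, U.IsInternalEnt M ∧ (∀ m : Ent U.Y, m.1 ∈ M.1 → m.1 ∈ T.1) ∧
      (∀ m : Ent U.Y, m.1 ∈ M.1 → ∀ r : Ent U.Y, r.1 ∈ T.1 → ∀ s : Ent U.Y, s.1 ∈ T.1 →
        GraphRel H m r s → s.1 ∈ M.1) ∧
      (∃ m : Ent U.Y, m.1 ∈ M.1 ∧ m.1 ∈ V.1) ∧
      ∀ y : Ent U.Y, y.1 ∈ M.1 →
        (∃ m : Ent U.Y, m.1 ∈ M.1 ∧ ∃ u : Ent U.Y, u.1 ∈ T.1 ∧ u.1 ∈ V.1 ∧ GraphRel H y m u) →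
        ∀ z : Ent U.Y, z.1 ∈ M.1 → z.1 ∈ F.1 →
          (∀ x : Ent U.Y, x.1 ∈ M.1 → x.1 ∈ F.1 →
            ∃ p : Ent U.Y, p.1 ∈ M.1 ∧ p.1 ∈ F.1 ∧ GraphRel H y x p) →
          ∃ x : Ent U.Y, x.1 ∈ M.1 ∧ x.1 ∈ F.1 ∧ GraphRel H y x z := by
  have hT' := hT.isInternalSet.isInternalEnt
  obtain ⟨A, hA, hAX, hTA⟩ := hT
  have hD := finiteSubsets_mem_superstructure hA hAX
  have hDX := finiteSubsets_not_mem U.isBaseSet_X hA hAX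
  obtain ⟨n, hn⟩ := exists_forall_mem_star_superLevel hT' hH hV hF hF fun _ => T
  -- Variable 6 is the set of finite subsets of `A`: on the standard side it makes the semigroup
  -- finite, and on the nonstandard side it bounds `M` and so makes it internal. Variable 4 is idle
  -- and repeats `F`.
  let c : ℕ → Ent U.X := fun i =>
    if i = 6 then ⟨_, hD⟩ else levelEnt U.X n
  have key := U.holds_of_forall_mem (k := 5) (j := 5) rightIdealFormula c le_rfl
    (fun v hv hv' => ?_) (assign T H V F F fun i => U.starEnt (c i)) (fun i hi => ?_)
    (fun i hi => ?_)
  · rw [holds_rightIdealFormula U.isBaseSet_Y] at key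
    obtain ⟨M, hM, h⟩ := key ⟨hTA, total, functional, assoc, hTV⟩
    exact ⟨M, isInternalEnt_of_mem_star hD hDX hM, h⟩
  · rw [holds_rightIdealFormula U.isBaseSet_X, hv' 6 (by norm_num)]
    rintro ⟨hT, total, functional, assoc, hV⟩
    obtain ⟨hTA, hTfin⟩ := mem_finiteSubsets.1 (hT : (v 0).1 ∈ finiteSubsets A)
    obtain ⟨M, hMT, hMr, hMV, h⟩ := exists_rightIdeal_of_finite (α := Ent U.X)
      (T := {x | x.1 ∈ (v 0).1}) (V := {x | x.1 ∈ (v 2).1})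
      (Set.Finite.preimage Subtype.val_injective.injOn hTfin) total functional assoc hV
    let M' : ZFSet.{v} := A.sep fun x => ∃ hx : x ∈ superstructure U.X, (⟨x, hx⟩ : Ent U.X) ∈ M
    have mem_M' : ∀ x : Ent U.X, x.1 ∈ M' ↔ x ∈ M := fun x =>
      ⟨fun hx => (ZFSet.mem_sep.1 hx).2.2, fun hx => ZFSet.mem_sep.2 ⟨hTA (hMT hx), x.2, hx⟩⟩
    have hM'D : M' ∈ finiteSubsets A := by
      refine mem_finiteSubsets.2 ⟨fun x hx => (ZFSet.mem_sep.1 hx).1,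
        hTfin.subset fun x hx => ?_⟩
      obtain ⟨-, hx', h⟩ := ZFSet.mem_sep.1 hx
      exact hMT h
    refine ⟨⟨M', mem_superstructure_of_mem hD hDX hM'D⟩, hM'D, ?_⟩
    simp only [mem_M']
    exact ⟨fun m hm => hMT hm, hMr, hMV, fun y hy hy' => h y hy hy' {x | x.1 ∈ (v 3).1}⟩
  · have := hn i hi
    match i, hi with
    | 0, _ => exact this
    | 1, _ => exact this
    | 2, _ => exact this
    | 3, _ => exact this
    | 4, _ => exact this
  · rw [assign_of_le _ _ _ _ _ _ hi]

end NonstandardUniverse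

/-! ### Internal sets in a hyperfinite topological triple -/

namespace NonstandardUniverse

variable {U : NonstandardUniverse.{v}} {κ : Cardinal.{v + 1}}

theorem exists_internalSet_pair_mem {W E : ZFSet.{v}} {x : Ent U.Y} (hW : U.IsInternalSet W)
    (hx : U.IsInternalEnt x) (hE : U.IsInternalSet E) :
    ∃ S, U.IsInternalSet S ∧ ∀ y, y ∈ S ↔ y ∈ W ∧ ZFSet.pair x.1 y ∈ E := by
  have h : ∀ {Z : ZFSet.{v}} (_ : IsBaseSet Z) (v : ℕ → Ent Z),
      (pairMem 1 20 2).Holds v ↔ ZFSet.pair (v 1).1 (v 20).1 ∈ (v 2).1 :=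
    fun hZ v => holds_pairMem hZ v (by norm_num) (by norm_num)
  obtain ⟨r, S, hS, hmem⟩ := exists_internalSet_sep (U := U) (pairMem 1 20 2)
    (fun v S => by simp [h U.isBaseSet_X])
    (fun v S => by simp [h U.isBaseSet_Y])
    hW.isInternalEnt hx hE.isInternalEnt hx hx
  refine ⟨S, hS, fun y => ⟨fun hy => ?_, fun hy => ?_⟩⟩
  · exact ((hmem ⟨y, hS.mem_superstructure_of_mem hy⟩).1 hy).imp_right (h U.isBaseSet_Y _).1
  · exact (hmem ⟨y, hW.mem_superstructure_of_mem hy.1⟩).2 (hy.imp_right (h U.isBaseSet_Y _).2)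

theorem exists_internalSet_forall_pair_mem {W : ZFSet.{v}} {x : Ent U.Y} (hW : U.IsInternalSet W)
    (hx : U.IsInternalEnt x) {𝓔 : Set ZFSet.{v}} (hfin : 𝓔.Finite)
    (hE : ∀ E ∈ 𝓔, U.IsInternalSet E) :
    ∃ S, U.IsInternalSet S ∧ ∀ y, y ∈ S ↔ y ∈ W ∧ ∀ E ∈ 𝓔, ZFSet.pair x.1 y ∈ E := by
  induction 𝓔, hfin using Set.Finite.induction_on with
  | empty => exact ⟨W, hW, by simp⟩
  | @insert E 𝓔 _ _ ih =>
    obtain ⟨S, hS, hmem⟩ := ih fun E hE' => hE E (Set.mem_insert_of_mem _ hE')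
    obtain ⟨S', hS', hmem'⟩ := exists_internalSet_pair_mem hS hx (hE E (Set.mem_insert _ _))
    refine ⟨S', hS', fun y => ?_⟩
    rw [hmem', hmem, Set.forall_mem_insert]
    tauto

/-- The internal set of those `y ∈ F` which, if they are in `M`, satisfy
`y (F ∩ M) ⊆ (F ∩ M) \ {z}`. -/
theorem exists_internalSet_mapsTo {F : ZFSet.{v}} {M H z : Ent U.Y} (hF : U.IsInternalSet F)
    (hM : U.IsInternalEnt M) (hH : U.IsInternalEnt H) (hz : U.IsInternalEnt z) :
    ∃ S, U.IsInternalSet S ∧ ∀ y : Ent U.Y, y.1 ∈ S ↔ y.1 ∈ F ∧ (y.1 ∈ M.1 →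
      (∀ x : Ent U.Y, x.1 ∈ M.1 → x.1 ∈ F →
        ∃ p : Ent U.Y, p.1 ∈ M.1 ∧ p.1 ∈ F ∧ GraphRel H y x p) ∧
      ¬ ∃ x : Ent U.Y, x.1 ∈ M.1 ∧ x.1 ∈ F ∧ GraphRel H y x z) := by
  let φ : BoundedSetFormula := imp (mem 20 1) (and
    (ball 13 1 (imp (mem 13 0) (bex 14 1 (and (mem 14 0) (tripleMem 20 13 14 2)))))
    (neg (bex 13 1 (and (mem 13 0) (tripleMem 20 13 3 2)))))
  have h : ∀ {Z : ZFSet.{v}} (_ : IsBaseSet Z) (v : ℕ → Ent Z), φ.Holds v ↔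
      ((v 20).1 ∈ (v 1).1 → (∀ x : Ent Z, x.1 ∈ (v 1).1 → x.1 ∈ (v 0).1 →
        ∃ p : Ent Z, p.1 ∈ (v 1).1 ∧ p.1 ∈ (v 0).1 ∧ GraphRel (v 2) (v 20) x p) ∧
      ¬ ∃ x : Ent Z, x.1 ∈ (v 1).1 ∧ x.1 ∈ (v 0).1 ∧ GraphRel (v 2) (v 20) x (v 3)) := by
    intro Z hZ v
    have T : ∀ (v : ℕ → Ent Z) {i j k l : ℕ} (_ : i < 90) (_ : j < 90) (_ : k < 90),
        (tripleMem i j k l).Holds v ↔ GraphRel (v l) (v i) (v j) (v k) :=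
      fun v _ _ _ _ hi hj hk => holds_tripleMem hZ v hi hj hk
    simp (disch := norm_num only) only [φ, holds_imp, holds_and, holds_ball, holds_neg,
      holds_bex, holds_mem, T]
    simp only [update_apply, Nat.reduceEqDiff, if_true, if_false,
      OfNat.zero_ne_ofNat, OfNat.one_ne_ofNat]
  obtain ⟨r, S, hS, hmem⟩ := exists_internalSet_sep (U := U) φ
    (fun v S => by
      simp only [h U.isBaseSet_X, update_apply, Nat.reduceEqDiff, if_false,
        OfNat.zero_ne_ofNat, OfNat.one_ne_ofNat])
    (fun v S => by
      simp only [h U.isBaseSet_Y, update_apply, Nat.reduceEqDiff, if_false,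
        OfNat.zero_ne_ofNat, OfNat.one_ne_ofNat])
    hF.isInternalEnt hM hH hz hz
  exact ⟨S, hS, fun y => (hmem y).trans (and_congr_right' (h U.isBaseSet_Y _))⟩

/-- The elements of a hyperfinite ring as entities. -/
def HyperfiniteRing.ent (R : U.HyperfiniteRing) (a : R.Elem) : Ent U.Y :=
  ⟨a.1, R.isHyperfinite.isInternalSet.mem_superstructure_of_mem a.2⟩

theorem HyperfiniteRing.isInternalEnt_ent (R : U.HyperfiniteRing) (a : R.Elem) :
    U.IsInternalEnt (R.ent a) :=
  R.isHyperfinite.isInternalSet.isInternalEnt_of_mem a.2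

namespace RingTriple

variable (τ : U.RingTriple κ)

theorem toHat_eq_iff {a b : τ.feasible} : τ.toHat a = τ.toHat b ↔ τ.rho a.1 b.1 :=
  Quotient.eq

theorem exists_toHat_eq (q : τ.Hat) : ∃ a, τ.toHat a = q := Quotient.exists_rep q

theorem isOpen_classesIn {F : ZFSet.{v}} (hF : U.IsInternalSet F)
    (h : ∀ x ∈ F, x ∈ Subtype.val '' τ.feasible) : IsOpen (τ.classesIn F) :=
  TopologicalSpace.isOpen_generateFrom_of_mem ⟨F, hF, h, rfl⟩

/-- If no generating set contained `q`, its only neighbourhood would be the whole space, which is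
impossible in a T1 space with a second point. -/
theorem exists_mem_classesIn [T1Space τ.Hat] [Nontrivial τ.Hat] (q : τ.Hat) :
    ∃ F, U.IsInternalSet F ∧ (∀ x ∈ F, x ∈ Subtype.val '' τ.feasible) ∧ q ∈ τ.classesIn F := by
  by_contra! hq
  obtain ⟨p, hp⟩ := exists_ne q
  have h : nhds q = ⊤ := by
    rw [TopologicalSpace.nhds_generateFrom]
    refine iInf₂_eq_top.2 ?_
    rintro _ ⟨hs, F, hF, hF', rfl⟩
    exact absurd hs (hq F hF hF')
  have := isOpen_compl_singleton.mem_nhds (show q ∈ ({p} : Set τ.Hat)ᶜ from hp.symm)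
  rw [h, Filter.mem_top] at this
  exact (this ▸ Set.mem_univ p : p ∈ ({p} : Set τ.Hat)ᶜ) rfl

theorem pair_mem_iff {𝓕 : Set ZFSet.{v}}
    (h : {w | ∃ x y : τ.R.Elem, τ.rho x y ∧ w = ZFSet.pair x.1 y.1} = {x | ∀ F ∈ 𝓕, x ∈ F})
    (x y : τ.R.Elem) : (∀ E ∈ 𝓕, ZFSet.pair x.1 y.1 ∈ E) ↔ τ.rho x y := by
  have h' := Set.ext_iff.1 h (ZFSet.pair x.1 y.1)
  simp only [Set.mem_ofPred_eq] at h'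
  rw [← h']
  constructor
  · rintro ⟨a, b, hab, hp⟩
    obtain ⟨h1, h2⟩ := ZFSet.pair_injective hp
    rwa [Subtype.ext h1, Subtype.ext h2]
  · exact fun hxy => ⟨x, y, hxy, rfl⟩

/-- Two different classes can be separated by an internal set which contains the one and is
disjoint from the other. -/
theorem exists_internalSet_separating (hU : U.IsSaturated κ) {W : ZFSet.{v}}
    (hW : U.IsInternalSet W) (hWT : ∀ x ∈ W, x ∈ Subtype.val '' τ.feasible) {a b : τ.feasible}
    (hab : ¬ τ.rho a.1 b.1) (ha : τ.toHat a ∈ τ.classesIn W) :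
    ∃ V, U.IsInternalSet V ∧ V ⊆ W ∧ τ.toHat a ∈ τ.classesIn V ∧
      ∀ c : τ.feasible, c.1.1 ∈ V → ¬ τ.rho b.1 c.1 := by
  obtain ⟨𝓕, h𝓕ne, h𝓕, hcard, hrho⟩ := τ.pi_rho
  have hB : ∀ E ∈ 𝓕, ∃ S, U.IsInternalSet S ∧
      ∀ y, y ∈ S ↔ (y ∈ W ∧ ZFSet.pair a.1.1 y ∈ E) ∧ ZFSet.pair b.1.1 y ∈ E := by
    intro E hE
    obtain ⟨S, hS, hmem⟩ :=
      exists_internalSet_pair_mem hW (τ.R.isInternalEnt_ent a.1) (h𝓕 E hE)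
    obtain ⟨S', hS', hmem'⟩ :=
      exists_internalSet_pair_mem hS (τ.R.isInternalEnt_ent b.1) (h𝓕 E hE)
    exact ⟨S', hS', fun y => by rw [hmem', hmem]; rfl⟩
  choose! B hBint hBmem using hB
  -- A common element of all `B E` would be `ρ`-equivalent to both `a` and `b`. By saturation
  -- finitely many `E` already exclude it, and these define `V` from `a` alone.
  obtain ⟨𝓔, h𝓔, h𝓔fin, hno⟩ : ∃ 𝓔 ⊆ 𝓕, 𝓔.Finite ∧ ¬ ∃ x ∈ W, ∀ E ∈ 𝓔, x ∈ B E := by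
    by_contra! hcon
    obtain ⟨x, hx⟩ := hU (B '' 𝓕) (by rintro _ ⟨E, hE, rfl⟩; exact hBint E hE)
      (Cardinal.mk_image_le.trans hcard) (by
        intro 𝓖 h𝓖 hfin
        obtain ⟨𝓔, h1, h2, rfl⟩ := Set.exists_subset_image_finite_and.1 ⟨𝓖, h𝓖, hfin, rfl⟩
        obtain ⟨x, -, hx⟩ := hcon 𝓔 h1 h2
        exact ⟨x, by rintro _ ⟨E, hE, rfl⟩; exact hx E hE⟩)
    have hx' : ∀ E ∈ 𝓕, (x ∈ W ∧ ZFSet.pair a.1.1 x ∈ E) ∧ ZFSet.pair b.1.1 x ∈ E :=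
      fun E hE => (hBmem E hE x).1 (hx _ ⟨E, hE, rfl⟩)
    obtain ⟨E, hE⟩ := h𝓕ne
    obtain ⟨c, hc, rfl⟩ := hWT x (hx' E hE).1.1
    exact hab (τ.rho.trans ((τ.pair_mem_iff hrho a.1 c).1 fun E hE => (hx' E hE).1.2)
      (τ.rho.symm ((τ.pair_mem_iff hrho b.1 c).1 fun E hE => (hx' E hE).2)))
  obtain ⟨V, hV, hVmem⟩ := exists_internalSet_forall_pair_mem hW (τ.R.isInternalEnt_ent a.1) h𝓔fin
    fun E hE => h𝓕 E (h𝓔 hE)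
  refine ⟨V, hV, fun y hy => ((hVmem y).1 hy).1, fun c hc => ?_, fun c hc hbc => hno ?_⟩
  · have hac := τ.rho.symm (τ.toHat_eq_iff.1 hc)
    exact (hVmem _).2 ⟨ha c hc, fun E hE => (τ.pair_mem_iff hrho a.1 c.1).2 hac E (h𝓔 hE)⟩
  · obtain ⟨hcW, hcE⟩ := (hVmem _).1 hc
    exact ⟨_, hcW, fun E hE => (hBmem E (h𝓔 hE) _).2
      ⟨⟨hcW, hcE E hE⟩, (τ.pair_mem_iff hrho b.1 c.1).2 hbc E (h𝓔 hE)⟩⟩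

end RingTriple

end NonstandardUniverse

/-! ### The contradiction for a non-discrete field -/

theorem mainTheorem5 (K : Type u) [Field K] [TopologicalSpace K] [IsTopologicalDivisionRing K]
    [T2Space K] [LocallyCompactSpace K] (hK : ¬ DiscreteTopology K)
    (κ : Cardinal.{v + 1}) (hκ : ℵ₀ ≤ κ) (U : NonstandardUniverse.{v}) (hU : U.IsSaturated κ) :
    ¬ U.AbstractlyApproximableByFiniteRings κ K := by
  rintro ⟨τ, f, -, hmul⟩
  have hT2 : T2Space τ.Hat := f.symm.t2Space
  have hnt : Nontrivial τ.Hat := f.toEquiv.nontrivial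
  let st : τ.feasible → K := fun a => f (τ.toHat a)
  have st_surj : ∀ k, ∃ a, st a = k := fun k => by
    obtain ⟨a, ha⟩ := τ.exists_toHat_eq (f.symm k)
    exact ⟨a, by simp [st, ha]⟩
  have st_eq : ∀ {a b}, st a = st b ↔ τ.toHat a = τ.toHat b := f.injective.eq_iff
  let mul : τ.feasible → τ.feasible → τ.feasible := fun a b =>
    ⟨a.1 * b.1, τ.mul_mem _ _ a.2 b.2⟩
  have st_mul : ∀ a b, st (mul a b) = st a * st b := fun a b => hmul (τ.toHat a) (τ.toHat b)
  obtain ⟨a₀, ha₀⟩ := st_surj 0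
  obtain ⟨a₁, ha₁⟩ := st_surj 1
  obtain ⟨F, hF, hFT, hF₀⟩ := τ.exists_mem_classesIn (τ.toHat a₀)
  obtain ⟨W, hW, hWT, hW₁⟩ := τ.exists_mem_classesIn (τ.toHat a₁)
  obtain ⟨V, hV, hVW, hV₁, hV₀⟩ := τ.exists_internalSet_separating hU hW hWT (b := a₀)
    (fun h => one_ne_zero (ha₁.symm.trans ((st_eq.2 (τ.toHat_eq_iff.2 h)).trans ha₀))) hW₁
  have hV_ne : ∀ c : τ.feasible, c.1.1 ∈ V → st c ≠ 0 := fun c hc h =>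
    hV₀ c hc (τ.toHat_eq_iff.1 (st_eq.1 (ha₀.trans h.symm)))
  have hV_one : ∀ c : τ.feasible, st c = 1 → c.1.1 ∈ V := fun c hc =>
    hV₁ c (st_eq.1 (hc.trans ha₁.symm))
  have hF_zero : ∀ c : τ.feasible, st c = 0 → c.1.1 ∈ F := fun c hc =>
    hF₀ c (st_eq.1 (hc.trans ha₀.symm))
  -- every neighbourhood of `0` contains a non-zero element
  have nondiscrete : ∀ F', U.IsInternalSet F' → (∀ x ∈ F', x ∈ Subtype.val '' τ.feasible) →
      τ.toHat a₀ ∈ τ.classesIn F' → ∃ k ≠ 0, ∀ c : τ.feasible, st c = k → c.1.1 ∈ F' := by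
    intro F' hF' hF'T h₀
    by_contra! hcon
    refine hK (discreteTopology_of_isOpen_singleton_zero ?_)
    have hopen := f.isOpen_image.2 (τ.isOpen_classesIn hF' hF'T)
    convert hopen
    refine (Set.eq_singleton_iff_unique_mem.2 ⟨?_, ?_⟩).symm
    · exact ⟨_, h₀, ha₀⟩
    rintro _ ⟨q, hq, rfl⟩
    by_contra hne
    obtain ⟨c, hc, hcF⟩ := hcon _ hne
    exact hcF (hq c (f.injective hc))
  obtain ⟨H, hH, hHmem⟩ := τ.R.internal_mul
  let T : Ent U.Y := ⟨_, τ.R.isHyperfinite.isInternalSet.mem_superstructure⟩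
  let H' : Ent U.Y := ⟨H, hH.mem_superstructure⟩
  let F' : Ent U.Y := ⟨F, hF.mem_superstructure⟩
  -- Together with `elem`, this translates statements on entities and the internal graph into
  -- statements on the ring.
  have graph : ∀ x y z : τ.R.Elem,
      NonstandardUniverse.GraphRel H' (τ.R.ent x) (τ.R.ent y) (τ.R.ent z) ↔ x * y = z := by
    intro x y z
    refine (hHmem _).trans ⟨?_, fun h => ⟨x, y, h ▸ rfl⟩⟩
    rintro ⟨a, b, h⟩
    obtain ⟨h1, h2⟩ := ZFSet.pair_injective h
    obtain ⟨h3, h4⟩ := ZFSet.pair_injective h1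
    obtain rfl := Subtype.ext (a1 := x) h3
    obtain rfl := Subtype.ext (a1 := y) h4
    exact (Subtype.ext h2).symm
  have elem : ∀ {p : Ent U.Y → Prop}, (∀ a : τ.R.Elem, p (τ.R.ent a)) →
      ∀ x : Ent U.Y, x.1 ∈ T.1 → p x := fun h x hx => h ⟨x.1, hx⟩
  obtain ⟨M, hM, hMT, hMr, ⟨m, hmM, hmV⟩, hMV⟩ :=
    NonstandardUniverse.exists_internal_rightIdeal
    (T := T) (H := H') (V := ⟨V, hV.mem_superstructure⟩) (F := F')
    τ.R.isHyperfinite hH.isInternalEnt hV.isInternalEnt hF.isInternalEnt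
    (elem fun x => elem fun y => ⟨τ.R.ent (x * y), (x * y).2, (graph _ _ _).2 rfl⟩)
    (elem fun x => elem fun y => elem fun z => elem fun z' h h' => by
      rw [graph] at h h'
      rw [← h, ← h'])
    (elem fun x => elem fun y => elem fun z => elem fun p => elem fun q => elem fun r h h' h'' => by
      rw [graph] at h h' h'' ⊢
      rw [← h', ← h, ← h'', mul_assoc])
    ⟨τ.R.ent a₁.1, a₁.1.2, hV_one a₁ ha₁⟩
  -- the right ideal `M` represents every element of `K`
  have hM_surj : ∀ k, ∃ c : τ.feasible, c.1.1 ∈ M.1 ∧ st c = k := by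
    intro k
    -- The element `m ∈ M ∩ V` is feasible with non-zero image, so multiplying it on the right by a
    -- representative of `(st m)⁻¹ * k` stays in `M` and gives `k`.
    obtain ⟨c, hc, hcm⟩ := hWT _ (hVW hmV)
    obtain ⟨d, hd⟩ := st_surj ((st ⟨c, hc⟩)⁻¹ * k)
    have hne := hV_ne ⟨c, hc⟩ (hcm ▸ hmV)
    refine ⟨mul ⟨c, hc⟩ d, ?_, ?_⟩
    · exact hMr (τ.R.ent c) (show c.1 ∈ M.1 from hcm ▸ hmM) (τ.R.ent d.1) d.1.2
        (τ.R.ent (c * d.1)) (c * d.1).2 ((graph _ _ _).2 rfl)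
    · rw [st_mul, hd, mul_inv_cancel_left₀ hne]
  obtain ⟨k, hk, hkF⟩ := nondiscrete F hF hFT hF₀
  obtain ⟨z, hzM, hz⟩ := hM_surj k
  obtain ⟨S, hS, hSmem⟩ :=
    NonstandardUniverse.exists_internalSet_mapsTo hF hM hH.isInternalEnt (τ.R.isInternalEnt_ent z.1)
  have hfeas : ∀ x : Ent U.Y, x.1 ∈ F → ∃ a : τ.feasible, τ.R.ent a.1 = x := fun x hx =>
    let ⟨c, hc, hcx⟩ := hFT _ hx
    ⟨⟨c, hc⟩, Subtype.ext hcx⟩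
  -- If `st y = 0`, then `st (y * x) = 0` for all `x ∈ F`, because `F` consists of feasible
  -- elements; so `y * x` lies in `F` and differs from `z`, whose image is `k ≠ 0`.
  have hS₀ : τ.toHat a₀ ∈ τ.classesIn S := by
    intro y hy
    have hy : st y = 0 := (st_eq.2 hy).trans ha₀
    refine (hSmem (τ.R.ent y.1)).2 ⟨hF_zero y hy, fun hyM => ⟨fun x hxM hxF => ?_, ?_⟩⟩
    · obtain ⟨x, rfl⟩ := hfeas x hxF
      refine ⟨τ.R.ent (y.1 * x.1), ?_, hF_zero (mul y x) (by rw [st_mul, hy, zero_mul]),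
        (graph _ _ _).2 rfl⟩
      exact hMr _ hyM (τ.R.ent x.1) x.1.2 _ (y.1 * x.1).2 ((graph _ _ _).2 rfl)
    · rintro ⟨x, hxM, hxF, hx⟩
      obtain ⟨x, rfl⟩ := hfeas x hxF
      have hyx : mul y x = z := Subtype.ext ((graph _ _ _).1 hx)
      rw [← hz, ← hyx, st_mul, hy, zero_mul] at hk
      exact hk rfl
  obtain ⟨l, hl, hlS⟩ := nondiscrete S hS
    (fun x hx => hFT x ((hSmem ⟨x, hS.mem_superstructure_of_mem hx⟩).1 hx).1) hS₀
  obtain ⟨y, hyM, hy⟩ := hM_surj l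
  -- The product `y * c` has image `1`, so it lies in `V` and `yM` meets `V`: the ideal property
  -- then yields a preimage of `z` in `F ∩ M`, which `y ∈ S` forbids.
  obtain ⟨c, hcM, hc⟩ := hM_surj l⁻¹
  obtain ⟨hmaps, hnot⟩ := ((hSmem (τ.R.ent y.1)).1 (hlS y hy)).2 hyM
  refine hnot (hMV _ hyM ⟨τ.R.ent c.1, hcM, τ.R.ent (y.1 * c.1), (y.1 * c.1).2, ?_,
    (graph _ _ _).2 rfl⟩ (τ.R.ent z.1) hzM (hkF z hz) hmaps)
  exact hV_one (mul y c) (by rw [st_mul, hy, hc, mul_inv_cancel₀ hl])
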